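/- Let $\mathbb T$ be the unit circle with normalized Lebesgue measure $m$, let $Z$ be the bilateral shift on $L^2(\mathbb T)=L^2(\mathbb T,m)$, $(Zf)(\zeta)=\zeta f(\zeta)$, and let $1$ be the constant function. For $\alpha\in\mathbb C$ let $T(\alpha)=Z-(1-\alpha)\,Z1\otimes 1$, where $\xi\otimes\eta$ denotes the operator $x\mapsto\langle x,\eta\rangle\xi$. For contractions $T,T'$ on a complex Hilbert space, $T$ is said to be Harnack dominated by $T'$ (and $T'$ to Harnack dominate $T$) if there is a constant $c\ge 1$ such that $\operatorname{Re} p(T)\le c\,\operatorname{Re} p(T')$ for every polynomial $p\in\mathbb C[z]$ with $\operatorname{Re} p(z)\ge 0$ for all $|z|\le 1$; here $\operatorname{Re}A=\frac12(A+A^*)$ and $\le$ is the usual order of self-adjoint operators. $T$ and $T'$ are Harnack equivalent if each is Harnack dominated by the other. Then $T(\alpha)$ is a contraction for $|\alpha|<1$, $T(\alpha')$ is unitary for $|\alpha'|=1$, and $T(1)=Z$. For all $\alpha,\beta\in\mathbb C$ with $|\alpha|<1$ and $|\beta|<1$, $T(\alpha)$ and $T(\beta)$ are Harnack equivalent. For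 all $\alpha,\alpha'\in\mathbb C$ with $|\alpha|<1$ and $|\alpha'|=1$, $T(\alpha)$ Harnack dominates the unitary operator $T(\alpha')$; in particular $T(\alpha)$ Harnack dominates $Z=T(1)$. -/

import Mathlib

open scoped ENNReal Real ComplexStarModule
open MeasureTheory

noncomputable section

section Harnack

variable {H : Type*} [NormedAddCommGroup H] [InnerProductSpace ℂ H] [CompleteSpace H]

/-- `T` is Harnack dominated by `T'` with constant `c`: for every analytic polynomial `p` with
`Re p ≥ 0` on the closed unit disc, `Re p(T) ≤ c Re p(T')`.  Here `ℜ A = (A + A*) / 2`, and `≤` is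
the order of self-adjoint operators (`A ≤ B` iff `B - A` is a positive operator). -/
def HarnackDominatedWith (c : ℝ) (T T' : H →L[ℂ] H) : Prop :=
  ∀ p : Polynomial ℂ, (∀ z : ℂ, ‖z‖ ≤ 1 → 0 ≤ (p.eval z).re) →
    (ℜ (Polynomial.aeval T p) : H →L[ℂ] H) ≤ c • (ℜ (Polynomial.aeval T' p) : H →L[ℂ] H)

/-- `T` is Harnack dominated by `T'` (equivalently, `T'` Harnack dominates `T`). -/
def HarnackDominated (T T' : H →L[ℂ] H) : Prop :=
  ∃ c : ℝ, 1 ≤ c ∧ HarnackDominatedWith c T T'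

/-- `T` and `T'` are Harnack equivalent: each one is Harnack dominated by the other. -/
def HarnackEquivalent (T T' : H →L[ℂ] H) : Prop :=
  HarnackDominated T T' ∧ HarnackDominated T' T

end Harnack

instance fact_zero_lt_two_pi : Fact (0 < 2 * π) := ⟨Real.two_pi_pos⟩

/-- The Hilbert space `L²(𝕋)`, where `𝕋 = ℝ / 2πℤ` carries its normalized Lebesgue measure. -/
abbrev L2Circle : Type :=
  Lp ℂ 2 (AddCircle.haarAddCircle (T := 2 * π))

/-- The bilateral shift on `L²(𝕋)`: multiplication by the essentially bounded function
`ζ = exp (i t)`, which is `fourier 1`. -/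
def bilateralShift : L2Circle →L[ℂ] L2Circle :=
  (ContinuousLinearMap.mul ℂ ℂ).holderL (AddCircle.haarAddCircle (T := 2 * π)) ∞ 2 2
    (fourierLp ∞ 1)

theorem coeFn_bilateralShift (f : L2Circle) :
    bilateralShift f =ᵐ[AddCircle.haarAddCircle] fun t => (AddCircle.toCircle t : ℂ) * f t := by
  have h := ContinuousLinearMap.coeFn_holder (r := 2) (ContinuousLinearMap.mul ℂ ℂ)
    (fourierLp (T := 2 * π) ∞ 1) f
  filter_upwards [h, coeFn_fourierLp (T := 2 * π) ∞ 1] with t ht ht'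
  rw [bilateralShift, ContinuousLinearMap.holderL_apply_apply, ht, ht']
  simp

theorem toCircle_eq_exp (t : ℝ) :
    (AddCircle.toCircle (t : AddCircle (2 * π)) : ℂ) = Complex.exp (Complex.I * t) := by
  rw [AddCircle.toCircle_apply_mk, div_self (by positivity), one_mul, Circle.coe_exp, mul_comm]

/-- The constant function `1` in `L²(𝕋)`. -/
def oneL2 : L2Circle := Lp.const 2 AddCircle.haarAddCircle (1 : ℂ)

/-- `T(α) = Z - (1 - α) Z1 ⊗ 1`, where `ξ ⊗ η` is the operator `x ↦ ⟨x, η⟩ ξ` (the scalar product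
being linear in its first argument here). -/
def rankOnePerturbation (α : ℂ) : L2Circle →L[ℂ] L2Circle :=
  bilateralShift - (1 - α) • InnerProductSpace.rankOne ℂ (bilateralShift oneL2) oneL2

end

/-! Let `P_T(w) = 2 Re (1 - wT)⁻¹ - 1` be the operator Poisson kernel. Integrating `Re p` against
`P_T(r ζ̄)` over the circle gives `Re p(rT)`, so a bound `P_T ≤ c P_T'` on the disc yields Harnack
domination as `r → 1` (`HarnackDominatedWith.of_poissonForm_le`).

For an isometry `V` and a unit vector `e` with `Vⁿe ⊥ e` for `n ≥ 1`, put `x = (1 - wT(α))⁻¹h`. Then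
`⟨P_{T(α)}(w)h, h⟩ = (1 - |w|²)‖x‖² + |w|²(1 - |α|²)|⟨x, e⟩|²`. Replacing `α` by `β` changes `x` to
`x + w(β - α)⟨x, e⟩u` with `u = (1 - wV)⁻¹Ve`. Since `u ⊥ e` and `(1 - |w|²)‖u‖² = 1`, the
coefficient `⟨x, e⟩` is unchanged and the extra norm is absorbed by the second term, which is
available because `|α| < 1`. -/

/-! ### The operator Poisson kernel of a contraction -/

section PoissonKernel

variable {H : Type*} [NormedAddCommGroup H] [InnerProductSpace ℂ H]

/-- The vector `(1 - wT)⁻¹ h`, as the sum of its Neumann series. -/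
noncomputable def neumannVector (T : H →L[ℂ] H) (w : ℂ) (h : H) : H := (∑' n : ℕ, (w • T) ^ n) h

/-- The quadratic form of the operator Poisson kernel `2 Re (1 - wT)⁻¹ - 1`. -/
noncomputable def poissonForm (T : H →L[ℂ] H) (w : ℂ) (h : H) : ℝ :=
  2 * (inner ℂ h (neumannVector T w h)).re - ‖h‖ ^ 2

theorem norm_smul_lt_one {T : H →L[ℂ] H} (hT : ‖T‖ ≤ 1) {w : ℂ} (hw : ‖w‖ < 1) :
    ‖w • T‖ < 1 := by
  rw [norm_smul]
  exact (mul_le_of_le_one_right (norm_nonneg _) hT).trans_lt hw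

theorem two_mul_re_inner_sub_norm_sq (x y : H) :
    2 * (inner ℂ (x - y) x).re - ‖x - y‖ ^ 2 = ‖x‖ ^ 2 - ‖y‖ ^ 2 := by
  have h1 := norm_sub_sq (𝕜 := ℂ) x y
  have h2 : (inner ℂ x y).re = (inner ℂ y x).re := by
    rw [← inner_conj_symm, Complex.conj_re]
  have h3 : (inner ℂ x x).re = ‖x‖ ^ 2 := (norm_sq_eq_re_inner (𝕜 := ℂ) x).symm
  simp only [RCLike.re_to_complex] at h1
  rw [inner_sub_left, Complex.sub_re, h1, h2, h3]
  ring

variable [CompleteSpace H]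

theorem neumannVector_sub {T : H →L[ℂ] H} (hT : ‖T‖ ≤ 1) {w : ℂ} (hw : ‖w‖ < 1) (h : H) :
    neumannVector T w h - w • T (neumannVector T w h) = h := by
  have := congrArg (fun A : H →L[ℂ] H => A h) (mul_neg_geom_series _ (norm_smul_lt_one hT hw))
  simpa [neumannVector, sub_mul] using this

theorem neumannVector_sub_smul {T : H →L[ℂ] H} (hT : ‖T‖ ≤ 1) {w : ℂ} (hw : ‖w‖ < 1) (x : H) :
    neumannVector T w (x - w • T x) = x := by
  have := congrArg (fun A : H →L[ℂ] H => A x) (geom_series_mul_neg _ (norm_smul_lt_one hT hw))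
  simpa [neumannVector, mul_sub] using this

theorem hasSum_neumannVector {T : H →L[ℂ] H} (hT : ‖T‖ ≤ 1) {w : ℂ} (hw : ‖w‖ < 1) (h : H) :
    HasSum (fun n : ℕ => w ^ n • (T ^ n) h) (neumannVector T w h) := by
  have hs := (summable_geometric_of_norm_lt_one (norm_smul_lt_one hT hw)).hasSum
  have := hs.mapL (ContinuousLinearMap.apply ℂ H h)
  simpa [neumannVector, smul_pow] using this

theorem hasSum_inner_neumannVector {T : H →L[ℂ] H} (hT : ‖T‖ ≤ 1) {w : ℂ} (hw : ‖w‖ < 1)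
    (g h : H) :
    HasSum (fun n : ℕ => w ^ n * inner ℂ g ((T ^ n) h)) (inner ℂ g (neumannVector T w h)) := by
  simpa [inner_smul_right] using (hasSum_neumannVector hT hw h).mapL (innerSL ℂ g)

/-- With `x = (1 - wT)⁻¹h`, substitute `h = x - wTx` and polarize. -/
theorem poissonForm_eq {T : H →L[ℂ] H} (hT : ‖T‖ ≤ 1) {w : ℂ} (hw : ‖w‖ < 1) (h : H) :
    poissonForm T w h =
      ‖neumannVector T w h‖ ^ 2 - ‖w‖ ^ 2 * ‖T (neumannVector T w h)‖ ^ 2 := by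
  have := two_mul_re_inner_sub_norm_sq (neumannVector T w h) (w • T (neumannVector T w h))
  rwa [neumannVector_sub hT hw, norm_smul, mul_pow] at this

end PoissonKernel

/-! ### Absolutely convergent Fourier series on the circle -/

section FourierSeries

theorem integral_fourier_eq_ite (n : ℤ) :
    ∫ t, fourier n t ∂(AddCircle.haarAddCircle (T := 2 * π)) = if n = 0 then 1 else 0 := by
  have h := fourierCoeff_fourier (T := 2 * π) n
  have := congrFun h 0
  simp [fourierCoeff, Pi.single_apply] at this
  simp [this, eq_comm]

theorem continuous_tsum_fourier {b : ℕ → ℂ} (hb : Summable fun n => ‖b n‖) (e : ℕ → ℤ) :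
    Continuous fun t : AddCircle (2 * π) => ∑' n, b n * fourier (e n) t := by
  refine continuous_tsum (fun n => by fun_prop) hb fun n t => ?_
  rw [norm_mul, fourier_apply, Circle.norm_coe, mul_one]

theorem integral_fourier_mul_tsum {b : ℕ → ℂ} (hb : Summable fun n => ‖b n‖) (e : ℕ → ℤ) (k : ℤ) :
    ∫ t, fourier k t * ∑' n, b n * fourier (e n) t ∂(AddCircle.haarAddCircle (T := 2 * π)) =
      ∑' n, if k + e n = 0 then b n else 0 := by
  have hc : ∀ n, Continuous fun t : AddCircle (2 * π) => b n * fourier (k + e n) t :=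
    fun n => by fun_prop
  have hi : ∀ n, Integrable (fun t : AddCircle (2 * π) => b n * fourier (k + e n) t)
      AddCircle.haarAddCircle := fun n =>
    (hc n).integrable_of_hasCompactSupport (HasCompactSupport.of_compactSpace _)
  have hn : ∀ n (t : AddCircle (2 * π)), ‖b n * fourier (k + e n) t‖ = ‖b n‖ := fun n t => by
    rw [norm_mul, fourier_apply, Circle.norm_coe, mul_one]
  have h := (hasSum_integral_of_summable_integral_norm hi (by simpa only [hn, integral_const,
    probReal_univ, one_smul] using hb)).tsum_eq
  calc _ = ∫ t, ∑' n, b n * fourier (k + e n) t ∂(AddCircle.haarAddCircle (T := 2 * π)) := by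
        congr 1
        ext t
        rw [← tsum_mul_left]
        congr 1
        ext n
        rw [fourier_add]
        ring
    _ = _ := by
        rw [← h]
        congr 1
        ext n
        rw [integral_const_mul, integral_fourier_eq_ite]
        split_ifs <;> simp

end FourierSeries

/-! ### From Poisson kernel inequalities to Harnack domination -/

section HarnackDomination

variable {H : Type*} [NormedAddCommGroup H] [InnerProductSpace ℂ H]

theorem summable_norm_pow_mul_inner {T : H →L[ℂ] H} (hT : ‖T‖ ≤ 1) {r : ℝ} (h0 : 0 ≤ r)
    (h1 : r < 1) (h : H) : Summable fun n : ℕ => ‖(r : ℂ) ^ n * inner ℂ h ((T ^ n) h)‖ := by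
  refine ((summable_geometric_of_lt_one h0 h1).mul_right (‖h‖ * ‖h‖)).of_nonneg_of_le
    (fun _ => norm_nonneg _) fun n => ?_
  rw [norm_mul, norm_pow, Complex.norm_real, Real.norm_of_nonneg h0]
  gcongr
  refine (norm_inner_le_norm _ _).trans ?_
  gcongr
  refine ((T ^ n).le_opNorm h).trans (mul_le_of_le_one_left (norm_nonneg _) ?_)
  obtain rfl | hn := n.eq_zero_or_pos
  · exact ContinuousLinearMap.norm_id_le
  · exact (norm_pow_le' T hn).trans (pow_le_one₀ (norm_nonneg _) hT)

theorem integrable_haarAddCircle_of_continuous {E : Type*} [NormedAddCommGroup E]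
    {f : AddCircle (2 * π) → E} (hf : Continuous f) :
    Integrable f (AddCircle.haarAddCircle (T := 2 * π)) :=
  hf.integrable_of_hasCompactSupport (HasCompactSupport.of_compactSpace _)

theorem norm_ofReal_mul_fourier {r : ℝ} (h0 : 0 ≤ r) (n : ℤ) (t : AddCircle (2 * π)) :
    ‖(r : ℂ) * fourier n t‖ = r := by
  rw [norm_mul, fourier_apply, Circle.norm_coe, mul_one, Complex.norm_real, Real.norm_of_nonneg h0]

theorem fourier_neg_one_pow (n : ℕ) (t : AddCircle (2 * π)) :
    (fourier (-1) t : ℂ) ^ n = fourier (-(n : ℤ)) t := by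
  induction n with
  | zero => simp
  | succ n ih => rw [pow_succ, ih, ← fourier_add]; congr 2; push_cast; ring

theorem fourier_one_pow (n : ℕ) (t : AddCircle (2 * π)) :
    (fourier 1 t : ℂ) ^ n = fourier (n : ℤ) t := by
  induction n with
  | zero => simp
  | succ n ih => rw [pow_succ, ih, ← fourier_add]; congr 2

variable [CompleteSpace H]

/-- Twice the real part is the Neumann series plus its conjugate; the zeroth term is then counted
twice, whence the subtraction. Taking `w = r ζ̄` attaches `Tⁿ` to frequency `-n`, so that pairing
with `ζᵏ` picks out `Tᵏ`. -/
theorem poissonForm_fourier {T : H →L[ℂ] H} (hT : ‖T‖ ≤ 1) {r : ℝ} (h0 : 0 ≤ r) (h1 : r < 1)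
    (h : H) (t : AddCircle (2 * π)) :
    (poissonForm T (r * fourier (-1) t) h : ℂ) =
      (∑' n : ℕ, ((r : ℂ) ^ n * inner ℂ h ((T ^ n) h)) * fourier (-(n : ℤ)) t) +
      (∑' n : ℕ, (starRingEnd ℂ) ((r : ℂ) ^ n * inner ℂ h ((T ^ n) h)) * fourier (n : ℤ) t) -
      inner ℂ h h := by
  have hw : ‖(r : ℂ) * fourier (-1) t‖ < 1 := by rwa [norm_ofReal_mul_fourier h0]
  have hs : ∑' n : ℕ, ((r : ℂ) ^ n * inner ℂ h ((T ^ n) h)) * fourier (-(n : ℤ)) t =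
      inner ℂ h (neumannVector T (r * fourier (-1) t) h) := by
    rw [← (hasSum_inner_neumannVector hT hw h h).tsum_eq]
    congr 1
    ext n
    rw [mul_pow, fourier_neg_one_pow]
    ring
  have hs' : ∑' n : ℕ, (starRingEnd ℂ) ((r : ℂ) ^ n * inner ℂ h ((T ^ n) h)) * fourier (n : ℤ) t =
      (starRingEnd ℂ) (inner ℂ h (neumannVector T (r * fourier (-1) t) h)) := by
    rw [← hs, Complex.conj_tsum]
    congr 1
    ext n
    rw [map_mul _ _ (fourier (-(n : ℤ)) t), fourier_neg, Complex.conj_conj]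
  rw [hs, hs', Complex.add_conj, inner_self_eq_norm_sq_to_K, poissonForm]
  push_cast
  rfl

theorem continuous_poissonForm_fourier {T : H →L[ℂ] H} (hT : ‖T‖ ≤ 1) {r : ℝ} (h0 : 0 ≤ r)
    (h1 : r < 1) (h : H) :
    Continuous fun t : AddCircle (2 * π) => poissonForm T (r * fourier (-1) t) h := by
  have hb := summable_norm_pow_mul_inner hT h0 h1 h
  have hb' : Summable fun n : ℕ => ‖(starRingEnd ℂ) ((r : ℂ) ^ n * inner ℂ h ((T ^ n) h))‖ := by
    simpa only [RCLike.norm_conj] using hb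
  have hc := ((continuous_tsum_fourier hb fun n => -(n : ℤ)).add
    (continuous_tsum_fourier hb' fun n => (n : ℤ))).sub (continuous_const (y := inner ℂ h h))
  exact (Complex.continuous_re.comp hc).congr fun t =>
    (congrArg Complex.re (poissonForm_fourier hT h0 h1 h t)).symm

/-- The nonnegative Fourier coefficients of the Poisson kernel of `T`. -/
theorem integral_fourier_mul_poissonForm {T : H →L[ℂ] H} (hT : ‖T‖ ≤ 1) {r : ℝ} (h0 : 0 ≤ r)
    (h1 : r < 1) (h : H) (k : ℕ) :
    ∫ t, fourier (k : ℤ) t * (poissonForm T (r * fourier (-1) t) h : ℂ)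
      ∂(AddCircle.haarAddCircle (T := 2 * π)) = (r : ℂ) ^ k * inner ℂ h ((T ^ k) h) := by
  have hb := summable_norm_pow_mul_inner hT h0 h1 h
  have hb' : Summable fun n : ℕ => ‖(starRingEnd ℂ) ((r : ℂ) ^ n * inner ℂ h ((T ^ n) h))‖ := by
    simpa only [RCLike.norm_conj] using hb
  have hf : Continuous (fourier (T := 2 * π) (k : ℤ)) := map_continuous _
  have hc : Continuous fun t : AddCircle (2 * π) => fourier (k : ℤ) t *
      ∑' n : ℕ, ((r : ℂ) ^ n * inner ℂ h ((T ^ n) h)) * fourier (-(n : ℤ)) t :=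
    hf.mul (continuous_tsum_fourier hb fun n => -(n : ℤ))
  have hc' : Continuous fun t : AddCircle (2 * π) => fourier (k : ℤ) t *
      ∑' n : ℕ, (starRingEnd ℂ) ((r : ℂ) ^ n * inner ℂ h ((T ^ n) h)) * fourier (n : ℤ) t :=
    hf.mul (continuous_tsum_fourier hb' fun n => (n : ℤ))
  have hc'' : Continuous fun t : AddCircle (2 * π) => fourier (k : ℤ) t * inner ℂ h h :=
    hf.mul continuous_const
  simp_rw [poissonForm_fourier hT h0 h1 h, mul_sub, mul_add]
  have hi := integrable_haarAddCircle_of_continuous (hc.fun_add hc')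
  rw [integral_sub hi (integrable_haarAddCircle_of_continuous hc''),
    integral_add (integrable_haarAddCircle_of_continuous hc)
      (integrable_haarAddCircle_of_continuous hc'),
    integral_mul_const, integral_fourier_eq_ite,
    integral_fourier_mul_tsum hb fun n => -(n : ℤ), integral_fourier_mul_tsum hb' fun n => (n : ℤ)]
  have e1 : ∀ n : ℕ, ((k : ℤ) + -(n : ℤ) = 0) ↔ n = k := fun n => by omega
  have e2 : ∀ n : ℕ, ((k : ℤ) + (n : ℤ) = 0) ↔ n = 0 ∧ k = 0 := fun n => by omega
  simp only [e1, e2, tsum_ite_eq, ite_and]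
  -- The conjugate series contributes only when `k = 0`, and there it cancels against the subtracted
  -- `⟨h, h⟩`.
  by_cases hk : k = 0 <;> simp [hk]

theorem re_inner_realPart (A : H →L[ℂ] H) (h : H) :
    (inner ℂ h ((ℜ A : H →L[ℂ] H) h)).re = (inner ℂ h (A h)).re := by
  have : (inner ℂ h (star A h)).re = (inner ℂ h (A h)).re := by
    rw [ContinuousLinearMap.star_eq_adjoint, ContinuousLinearMap.adjoint_inner_right,
      ← inner_conj_symm, Complex.conj_re]
  rw [realPart_apply_coe, smul_apply, add_apply,
    inner_smul_right_eq_smul, inner_add_right, Complex.smul_re, Complex.add_re, this, smul_eq_mul]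
  ring

theorem realPart_le_smul_realPart {c : ℝ} {A B : H →L[ℂ] H}
    (hAB : ∀ h, (inner ℂ h (A h)).re ≤ c * (inner ℂ h (B h)).re) :
    (ℜ A : H →L[ℂ] H) ≤ c • (ℜ B : H →L[ℂ] H) := by
  rw [ContinuousLinearMap.le_def, ContinuousLinearMap.isPositive_def']
  refine ⟨(IsSelfAdjoint.smul (.all c) (ℜ B).2).sub (ℜ A).2, fun h => ?_⟩
  rw [ContinuousLinearMap.reApplyInnerSelf_apply, inner_re_symm, sub_apply,
    smul_apply, inner_sub_right, inner_smul_right_eq_smul, map_sub,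
    RCLike.smul_re]
  simp only [RCLike.re_to_complex, re_inner_realPart]
  linarith [hAB h]

/-- The Poisson formula for `Re ⟨p(rT)h, h⟩`. -/
theorem integral_re_eval_mul_poissonForm {T : H →L[ℂ] H} (hT : ‖T‖ ≤ 1) {r : ℝ} (h0 : 0 ≤ r)
    (h1 : r < 1) (h : H) (p : Polynomial ℂ) :
    ∫ t, (p.eval (fourier 1 t)).re * poissonForm T (r * fourier (-1) t) h
      ∂(AddCircle.haarAddCircle (T := 2 * π)) =
      (∑ k ∈ Finset.range (p.natDegree + 1),
        p.coeff k * ((r : ℂ) ^ k * inner ℂ h ((T ^ k) h))).re := by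
  have hP := Complex.continuous_ofReal.comp (continuous_poissonForm_fourier hT h0 h1 h)
  have hk : ∀ k : ℕ, Continuous fun t : AddCircle (2 * π) =>
      p.coeff k * (fourier (k : ℤ) t * (poissonForm T (r * fourier (-1) t) h : ℂ)) := fun k =>
    continuous_const.mul ((map_continuous _).mul hP)
  have key : ∀ t : AddCircle (2 * π),
      p.eval (fourier 1 t) * (poissonForm T (r * fourier (-1) t) h : ℂ) =
      ∑ k ∈ Finset.range (p.natDegree + 1),
        p.coeff k * (fourier (k : ℤ) t * (poissonForm T (r * fourier (-1) t) h : ℂ)) := fun t => by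
    rw [Polynomial.eval_eq_sum_range, Finset.sum_mul]
    refine Finset.sum_congr rfl fun k _ => ?_
    rw [mul_assoc]
    congr 2
    rw [fourier_one_pow]
  simp_rw [← integral_fourier_mul_poissonForm hT h0 h1 h, ← integral_const_mul]
  rw [← integral_finsetSum _ fun k _ => integrable_haarAddCircle_of_continuous (hk k),
    ← RCLike.re_to_complex, ← integral_re
      (integrable_haarAddCircle_of_continuous (continuous_finsetSum _ fun k _ => hk k))]
  congr 1
  ext t
  rw [← key t, RCLike.re_to_complex, Complex.re_mul_ofReal]

/-- A pointwise inequality between operator Poisson kernels gives Harnack domination. -/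
theorem HarnackDominatedWith.of_poissonForm_le {c : ℝ} {T T' : H →L[ℂ] H} (hT : ‖T‖ ≤ 1)
    (hT' : ‖T'‖ ≤ 1)
    (hle : ∀ (w : ℂ) (h : H), ‖w‖ < 1 → poissonForm T w h ≤ c * poissonForm T' w h) :
    HarnackDominatedWith c T T' := by
  intro p hp
  refine realPart_le_smul_realPart fun h => ?_
  -- `F S r` is `Re ⟨p(rS)h, h⟩`, a polynomial in `r`; the Poisson formula compares it for `r < 1`,
  -- and continuity carries the comparison to `r = 1`.
  set F : (H →L[ℂ] H) → ℝ → ℝ := fun S r => (∑ k ∈ Finset.range (p.natDegree + 1),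
        p.coeff k * ((r : ℂ) ^ k * inner ℂ h ((S ^ k) h))).re with hF
  have hF1 : ∀ S, F S 1 = (inner ℂ h (Polynomial.aeval S p h)).re := fun S => by
    simp [hF, Polynomial.aeval_eq_sum_range]
  have hFc : ∀ S, Continuous (F S) := fun S => by fun_prop
  have hpc : Continuous fun t : AddCircle (2 * π) => (p.eval (fourier 1 t)).re :=
    Complex.continuous_re.comp (p.continuous.comp (map_continuous _))
  have hFle : ∀ r ∈ Set.Ico (0 : ℝ) 1, F T r ≤ c * F T' r := by
    rintro r ⟨h0, h1⟩
    rw [hF]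
    dsimp only
    rw [← integral_re_eval_mul_poissonForm hT h0 h1, ← integral_re_eval_mul_poissonForm hT' h0 h1,
      ← integral_const_mul]
    refine integral_mono (integrable_haarAddCircle_of_continuous (hpc.mul (continuous_poissonForm_fourier hT h0 h1 h)))
      ((integrable_haarAddCircle_of_continuous (hpc.mul (continuous_poissonForm_fourier hT' h0 h1 h))).const_mul c) fun t => ?_
    have hw : ‖(r : ℂ) * fourier (-1) t‖ < 1 := by rwa [norm_ofReal_mul_fourier h0]
    have hpt := hp (fourier 1 t) (by rw [fourier_apply, Circle.norm_coe])
    calc _ ≤ _ * (c * _) := mul_le_mul_of_nonneg_left (hle _ h hw) hpt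
      _ = _ := by ring
  rw [← hF1, ← hF1]
  have hcl : (1 : ℝ) ∈ closure (Set.Ico (0 : ℝ) 1) := by
    rw [closure_Ico zero_ne_one]
    exact Set.right_mem_Icc.2 zero_le_one
  exact le_on_closure hFle (hFc T).continuousOn ((hFc T').const_smul c).continuousOn hcl

end HarnackDomination

/-! ### Rank one perturbations of an isometry -/

section RankOnePerturbation

variable {H : Type*} [NormedAddCommGroup H] [InnerProductSpace ℂ H]

/-- The rank one perturbation `V - (1 - α) Ve ⊗ e` of an operator `V`. -/
noncomputable def rankOnePerturbationOf (V : H →L[ℂ] H) (e : H) (α : ℂ) : H →L[ℂ] H :=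
  V - (1 - α) • InnerProductSpace.rankOne ℂ (V e) e

theorem rankOnePerturbationOf_apply (V : H →L[ℂ] H) (e : H) (α : ℂ) (x : H) :
    rankOnePerturbationOf V e α x = V (x - ((1 - α) * inner ℂ e x) • e) := by
  simp [rankOnePerturbationOf, mul_smul]

/-- The map `1 - (1 - α) e ⊗ e` multiplies `e` by `α` and fixes its orthogonal complement. -/
theorem norm_sub_smul_inner_smul_sq {e : H} (he : ‖e‖ = 1) (α : ℂ) (x : H) :
    ‖x - ((1 - α) * inner ℂ e x) • e‖ ^ 2 = ‖x‖ ^ 2 - (1 - ‖α‖ ^ 2) * ‖inner ℂ e x‖ ^ 2 := by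
  have h := norm_sub_sq (𝕜 := ℂ) x (((1 - α) * inner ℂ e x) • e)
  rw [inner_smul_right, ← inner_conj_symm x e, mul_assoc, Complex.mul_conj, norm_smul, he,
    norm_mul] at h
  rw [h, mul_one, mul_pow, RCLike.re_to_complex, Complex.re_mul_ofReal, Complex.normSq_eq_norm_sq,
    ← Complex.normSq_eq_norm_sq (1 - α), ← Complex.normSq_eq_norm_sq α, Complex.normSq_apply,
    Complex.normSq_apply]
  simp only [Complex.sub_re, Complex.sub_im, Complex.one_re, Complex.one_im]
  ring

variable {V : H →L[ℂ] H} {e : H}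

theorem norm_rankOnePerturbationOf_apply_sq (hV : ∀ x, ‖V x‖ = ‖x‖) (he : ‖e‖ = 1) (α : ℂ) (x : H) :
    ‖rankOnePerturbationOf V e α x‖ ^ 2 = ‖x‖ ^ 2 - (1 - ‖α‖ ^ 2) * ‖inner ℂ e x‖ ^ 2 := by
  rw [rankOnePerturbationOf_apply, hV, norm_sub_smul_inner_smul_sq he]

theorem norm_rankOnePerturbationOf_le (hV : ∀ x, ‖V x‖ = ‖x‖) (he : ‖e‖ = 1) {α : ℂ}
    (hα : ‖α‖ ≤ 1) : ‖rankOnePerturbationOf V e α‖ ≤ 1 := by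
  refine ContinuousLinearMap.opNorm_le_bound _ zero_le_one fun x => ?_
  rw [one_mul]
  refine le_of_sq_le_sq ?_ (norm_nonneg _)
  rw [norm_rankOnePerturbationOf_apply_sq hV he]
  have : 0 ≤ 1 - ‖α‖ ^ 2 := sub_nonneg.2 (pow_le_one₀ (norm_nonneg _) hα)
  nlinarith [mul_nonneg this (sq_nonneg ‖inner ℂ e x‖)]

variable [CompleteSpace H]

theorem mem_unitary_of_norm_map_of_surjective {A : H →L[ℂ] H} (hA : ∀ x, ‖A x‖ = ‖x‖)
    (hs : Function.Surjective A) : A ∈ unitary (H →L[ℂ] H) := by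
  have h1 : star A * A = 1 := A.norm_map_iff_adjoint_comp_self.1 hA
  refine Unitary.mem_iff.2 ⟨h1, ?_⟩
  ext y
  obtain ⟨x, rfl⟩ := hs y
  exact congrArg A (congrArg (fun B : H →L[ℂ] H => B x) h1)

theorem rankOnePerturbationOf_mem_unitary (hV : ∀ x, ‖V x‖ = ‖x‖) (hs : Function.Surjective V)
    (he : ‖e‖ = 1) {α : ℂ} (hα : ‖α‖ = 1) :
    rankOnePerturbationOf V e α ∈ unitary (H →L[ℂ] H) := by
  refine mem_unitary_of_norm_map_of_surjective (fun x => ?_) fun y => ?_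
  · rw [← sq_eq_sq₀ (norm_nonneg _) (norm_nonneg _), norm_rankOnePerturbationOf_apply_sq hV he, hα]
    ring
  · obtain ⟨x, rfl⟩ := hs y
    have h0 : α ≠ 0 := norm_ne_zero_iff.1 (by rw [hα]; exact one_ne_zero)
    have hee : inner ℂ e e = (1 : ℂ) := by simp [inner_self_eq_norm_sq_to_K, he]
    -- The inverse of `1 - (1 - α) e ⊗ e` is the same expression with `α⁻¹` for `α`.
    refine ⟨x - ((1 - α⁻¹) * inner ℂ e x) • e, ?_⟩
    rw [rankOnePerturbationOf_apply, inner_sub_right, inner_smul_right, hee, sub_sub, ← add_smul]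
    have : (1 - α⁻¹) * inner ℂ e x +
        (1 - α) * (inner ℂ e x - (1 - α⁻¹) * inner ℂ e x * 1) = 0 := by
      field_simp
      ring
    rw [this, zero_smul, sub_zero]

/-- If the vectors `Vⁿe`, `n ≥ 1`, are orthogonal to `e`, then `(1 - wT(β))⁻¹ Ve = (1 - wV)⁻¹ Ve`
is orthogonal to `e` and has squared norm `(1 - |w|²)⁻¹`. -/
theorem neumannVector_isometry_spec (hV : ∀ x, ‖V x‖ = ‖x‖) (he : ‖e‖ = 1)
    (ho : ∀ n : ℕ, inner ℂ e ((V ^ (n + 1)) e) = 0) {w : ℂ} (hw : ‖w‖ < 1) :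
    inner ℂ e (neumannVector V w (V e)) = 0 ∧
      (1 - ‖w‖ ^ 2) * ‖neumannVector V w (V e)‖ ^ 2 = 1 := by
  have hV1 : ‖V‖ ≤ 1 :=
    ContinuousLinearMap.opNorm_le_bound _ zero_le_one fun x => by rw [hV, one_mul]
  have hi : ∀ x y, inner ℂ (V x) (V y) = inner ℂ x y :=
    V.inner_map_map_iff_adjoint_comp_self.2 (V.norm_map_iff_adjoint_comp_self.1 hV)
  have hp : ∀ n : ℕ, (V ^ n) (V e) = (V ^ (n + 1)) e := fun n => by rw [pow_succ]; rfl
  have hp' : ∀ n : ℕ, (V ^ n) (V e) = V ((V ^ n) e) := fun n => by rw [hp, pow_succ']; rfl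
  constructor
  · refine (hasSum_inner_neumannVector hV1 hw e (V e)).unique ?_
    simp only [hp, ho, mul_zero]
    exact hasSum_zero
  -- Since `V` preserves inner products, `⟨VⁿVe, Ve⟩ = ⟨Vⁿe, e⟩`, and only `n = 0` survives. The
  -- Poisson form at `Ve` is thus `2 - 1`, while `poissonForm_eq` evaluates it as `(1 - |w|²)‖u‖²`.
  · have h1 : inner ℂ (V e) (neumannVector V w (V e)) = 1 := by
      refine (hasSum_inner_neumannVector hV1 hw (V e) (V e)).unique ?_
      simp only [hp', hi]
      refine (hasSum_ite_eq 0 (1 : ℂ)).congr_fun ?_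
      rintro (_ | n)
      · simp [inner_self_eq_norm_sq_to_K, he]
      · rw [ho, mul_zero, if_neg n.succ_ne_zero]
    have h2 := poissonForm_eq hV1 hw (V e)
    rw [poissonForm, h1, hV, hV, he, Complex.one_re] at h2
    linarith

theorem poissonForm_rankOnePerturbationOf (hV : ∀ x, ‖V x‖ = ‖x‖) (he : ‖e‖ = 1) {α : ℂ}
    (hα : ‖α‖ ≤ 1) {w : ℂ} (hw : ‖w‖ < 1) (h : H) :
    poissonForm (rankOnePerturbationOf V e α) w h =
      (1 - ‖w‖ ^ 2) * ‖neumannVector (rankOnePerturbationOf V e α) w h‖ ^ 2 + ‖w‖ ^ 2 *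
        ((1 - ‖α‖ ^ 2) * ‖inner ℂ e (neumannVector (rankOnePerturbationOf V e α) w h)‖ ^ 2) := by
  rw [poissonForm_eq (norm_rankOnePerturbationOf_le hV he hα) hw,
    norm_rankOnePerturbationOf_apply_sq hV he]
  ring

/-- Comparison of the resolvents of two rank one perturbations of the same isometry. -/
theorem neumannVector_rankOnePerturbationOf_eq_add (hV : ∀ x, ‖V x‖ = ‖x‖) (he : ‖e‖ = 1)
    (ho : ∀ n : ℕ, inner ℂ e ((V ^ (n + 1)) e) = 0) {α β : ℂ} (hα : ‖α‖ ≤ 1) (hβ : ‖β‖ ≤ 1)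
    {w : ℂ} (hw : ‖w‖ < 1) (h : H) :
    neumannVector (rankOnePerturbationOf V e β) w h =
      neumannVector (rankOnePerturbationOf V e α) w h +
        (w * (β - α) * inner ℂ e (neumannVector (rankOnePerturbationOf V e α) w h)) •
          neumannVector V w (V e) := by
  have hV1 : ‖V‖ ≤ 1 :=
    ContinuousLinearMap.opNorm_le_bound _ zero_le_one fun x => by rw [hV, one_mul]
  have h1 := neumannVector_sub (norm_rankOnePerturbationOf_le hV he hα) hw h
  have h2 := neumannVector_sub hV1 hw (V e)
  have h3 := (neumannVector_isometry_spec hV he ho hw).1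
  set x := neumannVector (rankOnePerturbationOf V e α) w h
  set u := neumannVector V w (V e)
  set s := w * (β - α) * inner ℂ e x with hs
  -- It suffices that `(1 - wT(β))(x + su) = h`. As `T(β) - T(α) = (β - α) Ve ⊗ e`, the vector `x`
  -- alone gives `h - s Ve`; as `u ⊥ e`, `T(β)u = Vu`, so `su` restores `s Ve`.
  rw [← neumannVector_sub_smul (norm_rankOnePerturbationOf_le hV he hβ) hw (x + s • u)]
  congr 1
  have h4 : V u = V (u - ((1 - β) * inner ℂ e u) • e) := by rw [h3, mul_zero, zero_smul, sub_zero]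
  rw [map_add, map_smul, rankOnePerturbationOf_apply V e β u, ← h4, rankOnePerturbationOf_apply]
  rw [rankOnePerturbationOf_apply] at h1
  simp only [map_sub, map_smul] at h1 ⊢
  calc h = x - w • (V x - ((1 - β) * inner ℂ e x) • V e) + s • (u - w • V u) := by
        rw [← h1, h2, hs]
        module
    _ = _ := by module

theorem harnackDominated_rankOnePerturbationOf (hV : ∀ x, ‖V x‖ = ‖x‖) (he : ‖e‖ = 1)
    (ho : ∀ n : ℕ, inner ℂ e ((V ^ (n + 1)) e) = 0) {α β : ℂ} (hα : ‖α‖ < 1) (hβ : ‖β‖ ≤ 1) :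
    HarnackDominated (rankOnePerturbationOf V e β) (rankOnePerturbationOf V e α) := by
  have hd : 0 < 1 - ‖α‖ ^ 2 := by nlinarith [norm_nonneg α]
  have hK : 0 ≤ 9 / (1 - ‖α‖ ^ 2) := by positivity
  -- The `2` comes from `‖a + b‖² ≤ 2‖a‖² + 2‖b‖²`. The `9` is `2 · 4 + 1`, with `|β - α|² ≤ 4` and
  -- `1 - |β|² ≤ 1`; dividing by `1 - |α|²` matches the weight of `|⟨x, e⟩|²` in the kernel of
  -- `T(α)`.
  refine ⟨2 + 9 / (1 - ‖α‖ ^ 2), by linarith, .of_poissonForm_le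
    (norm_rankOnePerturbationOf_le hV he hβ) (norm_rankOnePerturbationOf_le hV he hα.le)
    fun w h hw => ?_⟩
  rw [poissonForm_rankOnePerturbationOf hV he hβ hw, poissonForm_rankOnePerturbationOf hV he hα.le hw,
    neumannVector_rankOnePerturbationOf_eq_add hV he ho hα.le hβ hw]
  obtain ⟨h3, h4⟩ := neumannVector_isometry_spec hV he ho hw
  set x := neumannVector (rankOnePerturbationOf V e α) w h
  set u := neumannVector V w (V e)
  set q := ‖inner ℂ e x‖ with hq
  set s := w * (β - α) * inner ℂ e x with hs
  have hw' : 0 ≤ 1 - ‖w‖ ^ 2 := by nlinarith [norm_nonneg w]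
  rw [inner_add_right, inner_smul_right, h3, mul_zero, add_zero, ← hq]
  have hba : ‖β - α‖ ^ 2 ≤ 4 := by
    have := (norm_sub_le β α).trans (add_le_add hβ hα.le)
    nlinarith [norm_nonneg (β - α)]
  have hxu : ‖x + s • u‖ ^ 2 ≤ 2 * ‖x‖ ^ 2 + 2 * (‖s‖ ^ 2 * ‖u‖ ^ 2) := by
    have h5 := norm_add_le x (s • u)
    rw [norm_smul] at h5
    nlinarith [norm_nonneg (x + s • u), sq_nonneg (‖x‖ - ‖s‖ * ‖u‖)]
  have hsq : ‖s‖ ^ 2 ≤ 4 * (‖w‖ ^ 2 * q ^ 2) := by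
    rw [hs, norm_mul, norm_mul, mul_pow, mul_pow, ← hq]
    nlinarith [mul_nonneg (sq_nonneg ‖w‖) (sq_nonneg q)]
  have hwq : 0 ≤ ‖w‖ ^ 2 * q ^ 2 := by positivity
  have hwx : 0 ≤ (1 - ‖w‖ ^ 2) * ‖x‖ ^ 2 := by positivity
  calc (1 - ‖w‖ ^ 2) * ‖x + s • u‖ ^ 2 + ‖w‖ ^ 2 * ((1 - ‖β‖ ^ 2) * q ^ 2)
      ≤ (1 - ‖w‖ ^ 2) * (2 * ‖x‖ ^ 2 + 2 * (‖s‖ ^ 2 * ‖u‖ ^ 2)) + ‖w‖ ^ 2 * q ^ 2 := by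
        have := mul_le_mul_of_nonneg_left hxu hw'
        nlinarith [mul_nonneg hwq (sq_nonneg ‖β‖)]
    _ = 2 * ((1 - ‖w‖ ^ 2) * ‖x‖ ^ 2) + 2 * ‖s‖ ^ 2 + ‖w‖ ^ 2 * q ^ 2 := by
        linear_combination 2 * ‖s‖ ^ 2 * h4
    _ ≤ 2 * ((1 - ‖w‖ ^ 2) * ‖x‖ ^ 2) + 9 * (‖w‖ ^ 2 * q ^ 2) := by linarith
    -- The added nonnegative terms are the cross terms of the product of the constant with the
    -- Poisson form.
    _ ≤ 2 * ((1 - ‖w‖ ^ 2) * ‖x‖ ^ 2) + 9 * (‖w‖ ^ 2 * q ^ 2) +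
        (9 / (1 - ‖α‖ ^ 2) * ((1 - ‖w‖ ^ 2) * ‖x‖ ^ 2) +
          2 * ((1 - ‖α‖ ^ 2) * (‖w‖ ^ 2 * q ^ 2))) := by
        have := mul_nonneg hK hwx
        have := mul_nonneg hd.le hwq
        linarith
    _ = _ := by
        field_simp
        ring

end RankOnePerturbation

/-! ### The bilateral shift in the Fourier basis -/

section BilateralShift

theorem norm_bilateralShift_apply (f : L2Circle) : ‖bilateralShift f‖ = ‖f‖ := by
  rw [Lp.norm_def, Lp.norm_def]
  congr 1
  refine eLpNorm_congr_norm_ae ?_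
  filter_upwards [coeFn_bilateralShift f] with t ht
  rw [ht, norm_mul, Circle.norm_coe, one_mul]

theorem bilateralShift_fourierLp (n : ℤ) :
    bilateralShift (fourierLp 2 n) = fourierLp 2 (n + 1) := by
  refine Lp.ext ?_
  filter_upwards [coeFn_bilateralShift (fourierLp 2 n), coeFn_fourierLp (T := 2 * π) 2 n,
    coeFn_fourierLp (T := 2 * π) 2 (n + 1)] with t h1 h2 h3
  rw [h1, h2, h3, ← fourier_one, ← fourier_add, add_comm]

/-- The range of an isometry is closed, and this one contains every exponential, hence the closure
of their span. -/
theorem bilateralShift_surjective : Function.Surjective bilateralShift := by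
  have hiso : Isometry bilateralShift :=
    AddMonoidHomClass.isometry_of_norm _ norm_bilateralShift_apply
  have hcl : IsClosed (bilateralShift.range : Set L2Circle) := by
    rw [LinearMap.coe_range]
    exact hiso.isClosedEmbedding.isClosed_range
  have hspan : Submodule.span ℂ (Set.range (fourierLp (T := 2 * π) 2)) ≤ bilateralShift.range := by
    rw [Submodule.span_le]
    rintro _ ⟨n, rfl⟩
    exact ⟨fourierLp 2 (n - 1), by
      rw [← sub_add_cancel n 1]; simpa using bilateralShift_fourierLp (n - 1)⟩
  have htop := Submodule.topologicalClosure_minimal _ hspan hcl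
  rw [span_fourierLp_closure_eq_top (by norm_num), top_le_iff] at htop
  exact LinearMap.range_eq_top.1 htop

theorem oneL2_eq_fourierLp : oneL2 = fourierLp 2 0 := by
  refine Lp.ext ?_
  filter_upwards [Lp.coeFn_const (p := 2) (μ := AddCircle.haarAddCircle (T := 2 * π)) (1 : ℂ),
    coeFn_fourierLp (T := 2 * π) 2 0] with t h1 h2
  rw [h2, fourier_zero, oneL2, h1]
  rfl

theorem norm_oneL2 : ‖oneL2‖ = 1 := by
  rw [oneL2_eq_fourierLp]
  exact orthonormal_fourier.1 0

theorem bilateralShift_pow_oneL2 (n : ℕ) : (bilateralShift ^ n) oneL2 = fourierLp 2 (n : ℤ) := by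
  induction n with
  | zero => simpa using oneL2_eq_fourierLp
  | succ n ih =>
    rw [pow_succ', mul_apply_eq_comp, ih, bilateralShift_fourierLp, Nat.cast_succ]

theorem inner_oneL2_bilateralShift_pow_succ (n : ℕ) :
    inner ℂ oneL2 ((bilateralShift ^ (n + 1)) oneL2) = 0 := by
  rw [bilateralShift_pow_oneL2, oneL2_eq_fourierLp]
  exact orthonormal_fourier.2 (by positivity : (0 : ℤ) < (n + 1 : ℕ)).ne

theorem rankOnePerturbation_one : rankOnePerturbation 1 = bilateralShift := by
  simp [rankOnePerturbation]

theorem harnackDominated_rankOnePerturbation {α β : ℂ} (hα : ‖α‖ < 1) (hβ : ‖β‖ ≤ 1) :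
    HarnackDominated (rankOnePerturbation β) (rankOnePerturbation α) :=
  harnackDominated_rankOnePerturbationOf norm_bilateralShift_apply norm_oneL2
    inner_oneL2_bilateralShift_pow_succ hα hβ

end BilateralShift

theorem mainTheorem12 :
    -- the operators are contractions, unitary on the unit circle, and `Z` is one of them
    (∀ α : ℂ, ‖α‖ < 1 → ‖rankOnePerturbation α‖ ≤ 1) ∧
    (∀ α' : ℂ, ‖α'‖ = 1 → rankOnePerturbation α' ∈ unitary (L2Circle →L[ℂ] L2Circle)) ∧
    rankOnePerturbation 1 = bilateralShift ∧
    -- all `T(α)` with `|α| < 1` are Harnack equivalent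
    (∀ α β : ℂ, ‖α‖ < 1 → ‖β‖ < 1 →
      HarnackEquivalent (rankOnePerturbation α) (rankOnePerturbation β)) ∧
    -- each of them Harnack dominates `T(α')` for `|α'| = 1`, in particular `Z`
    (∀ α α' : ℂ, ‖α‖ < 1 → ‖α'‖ = 1 →
      HarnackDominated (rankOnePerturbation α') (rankOnePerturbation α)) ∧
    (∀ α : ℂ, ‖α‖ < 1 → HarnackDominated bilateralShift (rankOnePerturbation α)) := by
  exact ⟨fun α hα => norm_rankOnePerturbationOf_le norm_bilateralShift_apply norm_oneL2 hα.le,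
    fun α' hα' => rankOnePerturbationOf_mem_unitary norm_bilateralShift_apply
      bilateralShift_surjective norm_oneL2 hα',
    rankOnePerturbation_one,
    fun α β hα hβ => ⟨harnackDominated_rankOnePerturbation hβ hα.le,
      harnackDominated_rankOnePerturbation hα hβ.le⟩,
    fun α α' hα hα' => harnackDominated_rankOnePerturbation hα hα'.le,
    fun α hα => rankOnePerturbation_one ▸ harnackDominated_rankOnePerturbation hα (by simp)⟩
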